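/- Let $k$ be a perfect field of characteristic $p>0$, let $R=k[x_1,\dots,x_n]$, and let $I\subseteq R$ be an unmixed ideal of height $c<\infty$ (so $I\neq R$; unmixed means that all associated primes of $R/I$ have the same height). Assume that $I=(f_1,\dots,f_s)$ and that $I$ has a reduction generated by $r$ elements, i.e. there is an ideal $\tilde I\subseteq I$ generated by $r$ elements with $\tilde I\, I^m=I^{m+1}$ for some $m\ge 0$. Let $S=R[u_{ij}]_{1\le i\le c,\,1\le j\le s}$ be a polynomial ring over $R$ in $cs$ variables, and put $$g_i=u_{i1}f_1+u_{i2}f_2+\cdots+u_{is}f_s\qquad(1\le i\le c).$$ Then $$\operatorname{fpt}_S\big((g_1,\dots,g_c)\big)\ \ge\ \frac{c}{r}\,\operatorname{fpt}_R(I).$$ (If $r=0$, then $I=0$ and $c=0$, and the right-hand side is read as $0$.) Here, for an ideal $\mathfrak a$ of a ring $A$ of characteristic $p$ and a real number $t\ge 0$, the pair $(A,\mathfrak a^t)$ is called $F$-pure if for all sufficiently large $e$ there is an element $d\in\mathfrak a^{\lfloor t(p^e-1)\rfloor}$ such that the $A$-linear map $A\to F^e_*A$, $1\mapsto F^e_*d$,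 splits, where $F^e_*A$ is $A$ viewed as an $A$-module through the $e$-th iterated Frobenius; and $\operatorname{fpt}_A(\mathfrak a)=\sup\{t\in\mathbb R_{\ge 0} : (A,\mathfrak a^t)\text{ is }F\text{-pure}\}\in[0,\infty]$. -/

import Mathlib

open scoped NNReal ENNReal

/-- `F^e_* R`: the additive group of `R`, on which `R` acts through the `e`-th iterate
of the Frobenius endomorphism, i.e. `r • F^e_* x = F^e_* (r ^ (p ^ e) * x)`. -/
def FrobeniusPushforward (R : Type*) (_p _e : ℕ) : Type _ := R

namespace FrobeniusPushforward

variable (R : Type*) [CommRing R] (p e : ℕ)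

instance instAddCommGroup : AddCommGroup (FrobeniusPushforward R p e) :=
  inferInstanceAs (AddCommGroup R)

/-- The element `F^e_* x` of `F^e_* R` that corresponds to `x`. -/
def of : R ≃+ FrobeniusPushforward R p e := AddEquiv.refl R

instance instModule [Fact p.Prime] [CharP R p] : Module R (FrobeniusPushforward R p e) :=
  Module.compHom R (iterateFrobenius R p e)

theorem smul_of [Fact p.Prime] [CharP R p] (r x : R) :
    r • of R p e x = of R p e (r ^ (p ^ e) * x) := rfl

end FrobeniusPushforward

section FPurity

variable {R : Type*} [CommRing R] (p : ℕ) [Fact p.Prime] [CharP R p]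

/-- The `R`-linear map `R → F^e_* R` with `1 ↦ F^e_* d` splits as a homomorphism
of `R`-modules. -/
def FrobeniusSplitsAlong (e : ℕ) (d : R) : Prop :=
  ∃ φ : FrobeniusPushforward R p e →ₗ[R] R,
    φ ∘ₗ LinearMap.toSpanSingleton R _ (FrobeniusPushforward.of R p e d) = LinearMap.id

/-- The pair `(R, I^t)` is `F`-pure: for all large `e` there is an element
`d ∈ I ^ ⌊t (p ^ e - 1)⌋` along which the map `R → F^e_* R` splits. -/
def IsFPurePair (I : Ideal R) (t : ℝ≥0) : Prop :=
  ∀ᶠ e : ℕ in Filter.atTop, ∃ d ∈ I ^ ⌊(t : ℝ) * ((p : ℝ) ^ e - 1)⌋₊,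
    FrobeniusSplitsAlong p e d

/-- The `F`-pure threshold of `(R, I)`: the supremum, in `[0, ∞]`, of all real `t ≥ 0` such that
the pair `(R, I^t)` is `F`-pure. -/
noncomputable def fPureThreshold (I : Ideal R) : ℝ≥0∞ :=
  ⨆ (t : ℝ≥0) (_ : IsFPurePair p I t), (t : ℝ≥0∞)

end FPurity

/-- All associated primes of `I` (i.e. of the module `R ⧸ I`) have the same height. -/
def Ideal.IsUnmixedIdeal {R : Type*} [CommRing R] (I : Ideal R) : Prop :=
  ∀ P ∈ associatedPrimes R (R ⧸ I), ∀ Q ∈ associatedPrimes R (R ⧸ I), P.height = Q.height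

/-- `J` is a reduction of `I`: `J ⊆ I` and `J * I ^ m = I ^ (m + 1)` for some `m ≥ 0`. -/
def Ideal.IsReductionOf {R : Type*} [CommRing R] (J I : Ideal R) : Prop :=
  J ≤ I ∧ ∃ m : ℕ, J * I ^ m = I ^ (m + 1)

/-- For `f₁, …, f_s ∈ R`, the generic combination `g_i = u_{i1} f₁ + ⋯ + u_{is} f_s` in the
polynomial ring `R[u_{ij}]`, `1 ≤ i ≤ c`, `1 ≤ j ≤ s`. -/
noncomputable def genericCombination {R : Type*} [CommRing R] (c : ℕ) {s : ℕ} (f : Fin s → R)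
    (i : Fin c) : MvPolynomial (Fin c × Fin s) R :=
  ∑ j : Fin s, MvPolynomial.X (i, j) * MvPolynomial.C (f j)

/-! Let q = p ^ e, let J = (h₁, …, h_r) be the reduction, and let d ∈ I ^ N split. For a maximal
ideal M, d lies outside `traceColon M`, while I ^ N ≤ J ^ (N - m); so some h^β with |β| = N - m lies
outside it too. If J ≤ M, every β_j < q, because q-th powers of elements of M lie in `traceColon M`.
By averaging, c of the β_j sum to at least c (N - m) / r, and that partial monomial is still outside
`traceColon M`. The exponents depend on M, so d' is taken to be the sum of all g^b with b_i < q and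
|b| ≥ N'. Different g^b have different multidegrees in the rows of u, so nothing cancels;
specializing u turns g^b into any monomial with exponent b in elements of I. Hence no `traceColon M`
contains all coefficients of d', and the Fedder-type criterion `frobeniusSplitsAlong_of_coeff`
splits d'. Letting e grow makes the rounding and the loss m negligible. -/

namespace FrobeniusPushforward

variable {R : Type*} [CommRing R] (p e : ℕ) [Fact p.Prime] [CharP R p]

/-- The ideal of all `x` such that every `R`-linear map `F^e_* R → R` sends `F^e_* x` into `M`. -/
def traceColon (M : Ideal R) : Ideal R where
  carrier := {x | ∀ φ : FrobeniusPushforward R p e →ₗ[R] R, φ (of R p e x) ∈ M}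
  add_mem' hx hy φ := by
    rw [map_add, map_add]
    exact M.add_mem (hx φ) (hy φ)
  zero_mem' φ := by simp
  smul_mem' y x hx φ := by
    let mulLeft : FrobeniusPushforward R p e →ₗ[R] FrobeniusPushforward R p e :=
      { toFun := fun z => of R p e (y * (of R p e).symm z)
        map_add' := fun a b => by rw [map_add, mul_add, map_add]
        map_smul' := fun a b => by
          obtain ⟨b, rfl⟩ := (of R p e).surjective b
          simp only [smul_of, AddEquiv.symm_apply_apply, RingHom.id_apply]
          rw [mul_left_comm] }
    exact hx (φ ∘ₗ mulLeft)

variable {p e}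

theorem mem_traceColon {M : Ideal R} {x : R} :
    x ∈ traceColon p e M ↔
      ∀ φ : FrobeniusPushforward R p e →ₗ[R] R, φ (of R p e x) ∈ M := Iff.rfl

theorem pow_mem_traceColon {M : Ideal R} {x : R} (hx : x ∈ M) :
    x ^ p ^ e ∈ traceColon p e M := fun φ => by
  have := smul_of R p e x 1
  rw [mul_one] at this
  rw [← this, map_smul]
  exact M.mul_mem_right _ hx

theorem frobeniusSplitsAlong_iff {d : R} :
    FrobeniusSplitsAlong p e d ↔
      ∃ φ : FrobeniusPushforward R p e →ₗ[R] R, φ (of R p e d) = 1 := by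
  refine exists_congr fun φ => ⟨fun h => ?_, fun h => ?_⟩
  · simpa using LinearMap.congr_fun h 1
  · ext
    simpa using h

theorem _root_.FrobeniusSplitsAlong.notMem_traceColon {d : R} (hd : FrobeniusSplitsAlong p e d)
    {M : Ideal R} (hM : M ≠ ⊤) : d ∉ traceColon p e M := fun h => by
  obtain ⟨φ, hφ⟩ := frobeniusSplitsAlong_iff.1 hd
  exact hM ((Ideal.eq_top_iff_one M).2 (hφ ▸ h φ))

/-- If some splitting exists, then `traceColon` of a prime ideal `M` has no powers of elements
outside `M`. -/
theorem _root_.FrobeniusSplitsAlong.mem_of_pow_mem_traceColon {d : R}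
    (hd : FrobeniusSplitsAlong p e d) {M : Ideal R} [hM : M.IsPrime] {x : R} {l : ℕ}
    (hx : x ^ l ∈ traceColon p e M) : x ∈ M := by
  obtain ⟨φ, hφ⟩ := frobeniusSplitsAlong_iff.1 hd
  have hq : 0 < p ^ e := pow_pos (Fact.out (p := p.Prime)).pos e
  -- The q-th power leaves φ as the scalar x ^ l, and φ sends d to 1.
  have h1 : (x ^ l) ^ p ^ e * d ∈ traceColon p e M :=
    Ideal.mul_mem_right _ _ (Ideal.pow_mem_of_mem _ hx _ hq)
  have h2 := h1 φ
  rw [← smul_of, map_smul, hφ, smul_eq_mul, mul_one] at h2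
  exact hM.mem_of_pow_mem _ h2

/-! ### Splittings over a polynomial ring -/

section MvPolynomial

open MvPolynomial

variable {σ : Type*}

variable (p e) in
/-- The additive map sending `a u^γ`, with `γ = α + p ^ e δ` and `α < p ^ e`, to `φ_α(a) u^δ`. -/
noncomputable def extendAddHom (φ : (σ →₀ ℕ) → FrobeniusPushforward R p e →ₗ[R] R) :
    MvPolynomial σ R →+ MvPolynomial σ R :=
  (Finsupp.liftAddHom fun γ : σ →₀ ℕ =>
    (monomial (γ.mapRange (· / p ^ e) (Nat.zero_div _))).toAddMonoidHom.comp
      ((φ (γ.mapRange (· % p ^ e) (Nat.zero_mod _))).toAddMonoidHom.comp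
        (of R p e).toAddMonoidHom)).comp AddMonoidAlgebra.coeffAddEquiv.toAddMonoidHom

theorem extendAddHom_monomial (φ : (σ →₀ ℕ) → FrobeniusPushforward R p e →ₗ[R] R)
    (γ : σ →₀ ℕ) (a : R) :
    extendAddHom p e φ (monomial γ a) =
      monomial (γ.mapRange (· / p ^ e) (Nat.zero_div _))
        (φ (γ.mapRange (· % p ^ e) (Nat.zero_mod _)) (of R p e a)) :=
  Finsupp.liftAddHom_apply_single _ _ _

theorem extendAddHom_pow_mul (φ : (σ →₀ ℕ) → FrobeniusPushforward R p e →ₗ[R] R)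
    (x y : MvPolynomial σ R) :
    extendAddHom p e φ (x ^ p ^ e * y) = x * extendAddHom p e φ y := by
  have hq : 0 < p ^ e := pow_pos (Fact.out (p := p.Prime)).pos e
  induction x using MvPolynomial.induction_on' with
  | add x x' hx hx' => rw [add_pow_char_pow, add_mul, map_add, hx, hx', add_mul]
  | monomial δ r =>
    induction y using MvPolynomial.induction_on' with
    | add y y' hy hy' => rw [mul_add, map_add, hy, hy', map_add, mul_add]
    | monomial γ a =>
      have hdiv : (p ^ e • δ + γ).mapRange (· / p ^ e) (Nat.zero_div _) =
          δ + γ.mapRange (· / p ^ e) (Nat.zero_div _) := by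
        ext i
        simp [Nat.mul_add_div hq]
      have hmod : (p ^ e • δ + γ).mapRange (· % p ^ e) (Nat.zero_mod _) =
          γ.mapRange (· % p ^ e) (Nat.zero_mod _) := by
        ext i
        simp
      rw [monomial_pow, monomial_mul, extendAddHom_monomial, extendAddHom_monomial, monomial_mul,
        hdiv, hmod, ← smul_of, map_smul, smul_eq_mul]

variable (p e) in
/-- The `R[u]`-linear extension of a family of maps `φ_α : F^e_* R → R` to `F^e_* R[u]`. -/
noncomputable def extend (φ : (σ →₀ ℕ) → FrobeniusPushforward R p e →ₗ[R] R) :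
    FrobeniusPushforward (MvPolynomial σ R) p e →ₗ[MvPolynomial σ R] MvPolynomial σ R where
  toFun x := extendAddHom p e φ ((of (MvPolynomial σ R) p e).symm x)
  map_add' x y := by rw [map_add, map_add]
  map_smul' x y := by
    obtain ⟨y, rfl⟩ := (of (MvPolynomial σ R) p e).surjective y
    simp only [smul_of, AddEquiv.symm_apply_apply, RingHom.id_apply, smul_eq_mul]
    exact extendAddHom_pow_mul φ x y

/-- When all exponents are below q, the monomials of d are part of the basis u^α, α < q, so the maps
φ_α act on the coefficients independently. -/
theorem extend_of_eq_sum (φ : (σ →₀ ℕ) → FrobeniusPushforward R p e →ₗ[R] R)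
    {d : MvPolynomial σ R} (hd : ∀ α ∈ d.support, ∀ i, α i < p ^ e) :
    extend p e φ (of _ p e d) = C (∑ α ∈ d.support, φ α (of R p e (d.coeff α))) := by
  change extendAddHom p e φ d = _
  conv_lhs => rw [d.as_sum]
  rw [map_sum, map_sum]
  refine Finset.sum_congr rfl fun α hα => ?_
  have hdiv : α.mapRange (· / p ^ e) (Nat.zero_div _) = 0 := by
    ext i
    simpa using Or.inr (hd α hα i)
  have hmod : α.mapRange (· % p ^ e) (Nat.zero_mod _) = α := by
    ext i
    simpa using Nat.mod_eq_of_lt (hd α hα i)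
  rw [extendAddHom_monomial, hdiv, hmod]
  rfl

/-- A Fedder-type criterion: a polynomial of small degree in each variable splits if for no maximal
ideal `M` of the base ring all of its coefficients lie in `traceColon M`. -/
theorem frobeniusSplitsAlong_of_coeff {d : MvPolynomial σ R}
    (hd : ∀ α ∈ d.support, ∀ i, α i < p ^ e)
    (h : ∀ M : Ideal R, M.IsMaximal → ∃ α, d.coeff α ∉ traceColon p e M) :
    FrobeniusSplitsAlong p e d := by
  classical
  let T : ((σ →₀ ℕ) → FrobeniusPushforward R p e →ₗ[R] R) →ₗ[R] R :=
    ∑ α ∈ d.support, LinearMap.applyₗ (of R p e (d.coeff α)) ∘ₗ LinearMap.proj α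
  have hT (φ : (σ →₀ ℕ) → FrobeniusPushforward R p e →ₗ[R] R) :
      T φ = ∑ α ∈ d.support, φ α (of R p e (d.coeff α)) := by
    simp [T]
  -- The values of T form an ideal of R, so reaching 1 can be tested at each maximal ideal.
  have htop : LinearMap.range T = ⊤ := by
    by_contra hne
    obtain ⟨M, hM, hle⟩ := Ideal.exists_le_maximal (LinearMap.range T) hne
    obtain ⟨α, hα⟩ := h M hM
    refine hα fun ψ => ?_
    have hmem : α ∈ d.support := by
      by_contra hα'
      rw [notMem_support_iff.1 hα'] at hα
      exact hα (zero_mem _)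
    have := hle ⟨Pi.single α ψ, rfl⟩
    rw [hT, Finset.sum_eq_single_of_mem α hmem fun β _ hβ => by simp [Pi.single_eq_of_ne hβ],
      Pi.single_eq_same] at this
    exact this
  obtain ⟨φ, hφ⟩ : (1 : R) ∈ LinearMap.range T := htop ▸ Submodule.mem_top
  refine frobeniusSplitsAlong_iff.2 ⟨extend p e φ, ?_⟩
  rw [extend_of_eq_sum φ hd, ← hT, hφ, C_1]

end MvPolynomial

end FrobeniusPushforward

/-! ### Reductions, powers of ideals and height -/

section Ideals

variable {R : Type*} [CommRing R]

theorem Ideal.IsReductionOf.pow_le {J I : Ideal R} {m : ℕ} (h : J * I ^ m = I ^ (m + 1)) (N : ℕ) :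
    I ^ N ≤ J ^ (N - m) := by
  have key (l : ℕ) : I ^ (m + l) = J ^ l * I ^ m := by
    induction l with
    | zero => simp
    | succ l ih => rw [← add_assoc, pow_succ, ih, mul_assoc, ← pow_succ, ← h, ← mul_assoc, pow_succ]
  rcases le_total m N with hN | hN
  · obtain ⟨l, rfl⟩ := Nat.exists_eq_add_of_le hN
    rw [key, Nat.add_sub_cancel_left]
    exact Ideal.mul_le_left (R := R)
  · simp [Nat.sub_eq_zero_of_le hN]

theorem Ideal.span_range_pow_le {r : ℕ} (h : Fin r → R) (N : ℕ) :
    Ideal.span (Set.range h) ^ N ≤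
      Ideal.span {x | ∃ β : Fin r → ℕ, ∑ j, β j = N ∧ ∏ j, h j ^ β j = x} := by
  induction N with
  | zero =>
    rw [pow_zero, Ideal.one_eq_top, top_le_iff, Ideal.eq_top_iff_one]
    exact Ideal.subset_span ⟨0, by simp, by simp⟩
  | succ N ih =>
    rw [pow_succ]
    refine (Ideal.mul_mono_left ih).trans ?_
    rw [Ideal.span_mul_span', Ideal.span_le]
    rintro _ ⟨_, ⟨β, hβ, rfl⟩, _, ⟨j, rfl⟩, rfl⟩
    refine Ideal.subset_span ⟨fun i => β i + (Pi.single j 1 : Fin r → ℕ) i, ?_, ?_⟩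
    · simp [Finset.sum_add_distrib, hβ]
    · simp_rw [pow_add, Finset.prod_mul_distrib]
      congr 1
      rw [Finset.prod_eq_single j (fun i _ hi => by simp [Pi.single_eq_of_ne hi]) (by simp)]
      simp

theorem Ideal.prod_pow_mem_pow {ι : Type*} [Fintype ι] (g : ι → R) (b : ι → ℕ) :
    ∏ i, g i ^ b i ∈ Ideal.span (Set.range g) ^ ∑ i, b i := by
  rw [← Finset.prod_pow_eq_pow_sum]
  exact Ideal.prod_mem_prod fun i _ => Ideal.pow_mem_pow
    (Ideal.subset_span (Set.mem_range_self i)) _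

theorem MvPolynomial.eval_mem_of_coeff_mem {σ : Type*} {K : Ideal R} {P : MvPolynomial σ R}
    (h : ∀ α, P.coeff α ∈ K) (a : σ → R) : MvPolynomial.eval a P ∈ K := by
  rw [MvPolynomial.eval_eq]
  exact K.sum_mem fun α _ => K.mul_mem_right _ (h α)

theorem Ideal.height_le_of_pow_le_span_range [IsNoetherianRing R] {I : Ideal R} {r l : ℕ}
    (h : Fin r → R) (hI : I ≠ ⊤) (hle : Ideal.span (Set.range h) ≤ I)
    (hpow : I ^ l ≤ Ideal.span (Set.range h)) : I.height ≤ r := by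
  have htop : Ideal.span (Set.range h) ≠ ⊤ := fun H => hI (top_le_iff.1 (H ▸ hle))
  obtain ⟨P, hP⟩ := Ideal.nonempty_minimalPrimes htop
  have : P.IsPrime := hP.1.1
  have hIP : I ≤ P := Ideal.IsPrime.le_of_pow_le (hpow.trans hP.1.2)
  refine (Ideal.height_mono hIP).trans
    ((Ideal.height_le_card_of_mem_minimalPrimes_span (Set.finite_range h) hP).trans ?_)
  rw [← Set.image_univ]
  exact_mod_cast (Set.ncard_image_le Set.finite_univ).trans (by simp)

end Ideals

/-- Among `r` natural numbers, some `c ≤ r` of them have at least the average sum. -/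
theorem exists_injective_mul_sum_le {c r : ℕ} (hcr : c ≤ r) (hr : 0 < r) (β : Fin r → ℕ) :
    ∃ τ : Fin c → Fin r, Function.Injective τ ∧ c * ∑ j, β j ≤ r * ∑ i, β (τ i) := by
  have : NeZero r := ⟨hr.ne'⟩
  -- Average over the r cyclic windows of length c: each index lies in exactly c of them.
  have hsum : ∑ a : Fin r, ∑ i : Fin c, β (Fin.castLE hcr i + a) = c * ∑ j, β j := by
    have (i : Fin c) : ∑ a : Fin r, β (Fin.castLE hcr i + a) = ∑ j, β j :=
      Equiv.sum_comp (Equiv.addLeft (Fin.castLE hcr i)) β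
    simp [Finset.sum_comm, this]
  obtain ⟨a, -, ha⟩ := Finset.exists_le_of_sum_le (s := (Finset.univ : Finset (Fin r)))
    (f := fun _ => c * ∑ j, β j) (g := fun a => r * ∑ i : Fin c, β (Fin.castLE hcr i + a))
    Finset.univ_nonempty (by
      rw [← Finset.mul_sum (f := fun a => ∑ i : Fin c, β (Fin.castLE hcr i + a)), hsum]
      simp)
  exact ⟨fun i => Fin.castLE hcr i + a,
    fun i j hij => Fin.castLE_injective hcr (add_right_cancel hij), ha⟩

/-! ### Monomials in the generic combinations -/

section GenericCombination

open MvPolynomial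

variable {R : Type*} [CommRing R] {c s : ℕ}

/-- The weight of `u_{ij}` is the `i`-th unit vector. -/
def rowWeight (c s : ℕ) (x : Fin c × Fin s) : Fin c → ℕ := Pi.single x.1 1

theorem le_weight_rowWeight (α : Fin c × Fin s →₀ ℕ) (x : Fin c × Fin s) :
    α x ≤ Finsupp.weight (rowWeight c s) α x.1 := by
  rw [Finsupp.weight_apply, Finsupp.sum_fintype _ _ (by simp), Finset.sum_apply]
  refine le_trans ?_ (Finset.single_le_sum
    (f := fun y => (α y • rowWeight c s y) x.1) (fun _ _ => Nat.zero_le _) (Finset.mem_univ x))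
  simp [rowWeight]

theorem isWeightedHomogeneous_genericCombination (f : Fin s → R) (i : Fin c) :
    IsWeightedHomogeneous (rowWeight c s) (genericCombination c f i) (Pi.single i 1) := by
  refine IsWeightedHomogeneous.sum _ _ _ fun j _ => ?_
  simpa [rowWeight] using (isWeightedHomogeneous_X R (rowWeight c s) (i, j)).mul
    (isWeightedHomogeneous_C (rowWeight c s) (f j))

theorem isWeightedHomogeneous_prod_genericCombination (f : Fin s → R) (b : Fin c → ℕ) :
    IsWeightedHomogeneous (rowWeight c s) (∏ i, genericCombination c f i ^ b i) b := by
  have := IsWeightedHomogeneous.prod Finset.univ (fun i => genericCombination c f i ^ b i)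
    (fun i => b i • Pi.single i 1) (w := rowWeight c s)
    fun i _ => (isWeightedHomogeneous_genericCombination f i).pow (b i)
  convert this using 1
  ext i
  simp [Finset.sum_apply, Pi.single_apply]

/-- The sum of the monomials in the generic combinations with exponents in `B`. -/
noncomputable def genericPowerSum (f : Fin s → R) (B : Finset (Fin c → ℕ)) :
    MvPolynomial (Fin c × Fin s) R :=
  ∑ b ∈ B, ∏ i, genericCombination c f i ^ b i

/-- The product with exponent b is homogeneous of row degree b, so each u^α occurs in at most one
summand. -/
theorem coeff_genericPowerSum (f : Fin s → R) (B : Finset (Fin c → ℕ))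
    (α : Fin c × Fin s →₀ ℕ) :
    (genericPowerSum f B).coeff α = if Finsupp.weight (rowWeight c s) α ∈ B then
      (∏ i, genericCombination c f i ^ Finsupp.weight (rowWeight c s) α i).coeff α else 0 := by
  rw [genericPowerSum, coeff_sum]
  have h0 (b : Fin c → ℕ) (hb : b ≠ Finsupp.weight (rowWeight c s) α) :
      (∏ i, genericCombination c f i ^ b i).coeff α = 0 :=
    (isWeightedHomogeneous_prod_genericCombination f b).coeff_eq_zero α hb.symm
  split_ifs with h
  · exact Finset.sum_eq_single_of_mem _ h fun b _ hb => h0 b hb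
  · exact Finset.sum_eq_zero fun b hb => h0 b fun H => h (H ▸ hb)

/-- An ideal that contains all coefficients of `genericPowerSum f B` contains the corresponding
monomials in arbitrary elements of the ideal generated by `f`. -/
theorem prod_pow_mem_of_coeff_genericPowerSum_mem (f : Fin s → R) {B : Finset (Fin c → ℕ)}
    {K : Ideal R} (hK : ∀ α, (genericPowerSum f B).coeff α ∈ K) {b : Fin c → ℕ} (hb : b ∈ B)
    {y : Fin c → R} (hy : ∀ i, y i ∈ Ideal.span (Set.range f)) : ∏ i, y i ^ b i ∈ K := by
  choose a ha using fun i => (Submodule.mem_span_range_iff_exists_fun R).1 (hy i)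
  have hcoeff (α) : (∏ i, genericCombination c f i ^ b i).coeff α ∈ K := by
    by_cases hα : Finsupp.weight (rowWeight c s) α = b
    · have := hK α
      rwa [coeff_genericPowerSum, hα, if_pos hb] at this
    · rw [(isWeightedHomogeneous_prod_genericCombination f b).coeff_eq_zero α hα]
      exact K.zero_mem
  -- Specializing u_{ij} to a_{ij}, where y_i = ∑ a_{ij} f_j, sends g_i to y_i.
  have := eval_mem_of_coeff_mem hcoeff fun x => a x.1 x.2
  rw [map_prod] at this
  convert this using 2 with i
  rw [map_pow, ← ha i, genericCombination, map_sum]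
  simp

end GenericCombination

/-! ### Comparison of the thresholds -/

section Threshold

open FrobeniusPushforward

variable {R : Type*} [CommRing R] {p : ℕ} [Fact p.Prime] [CharP R p]

theorem exists_frobeniusSplitsAlong_genericCombination {c s r e m N N' : ℕ} {I : Ideal R}
    (hI : I ≠ ⊤) (f : Fin s → R) (hf : I = Ideal.span (Set.range f)) (h : Fin r → R)
    (hle : Ideal.span (Set.range h) ≤ I)
    (hred : Ideal.span (Set.range h) * I ^ m = I ^ (m + 1)) (hcr : c ≤ r) (hr : 0 < r)
    (hN : r * N' ≤ c * (N - m)) {d : R} (hd : d ∈ I ^ N) (hsplit : FrobeniusSplitsAlong p e d) :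
    ∃ d' ∈ Ideal.span (Set.range (genericCombination c f)) ^ N', FrobeniusSplitsAlong p e d' := by
  have hq : 0 < p ^ e := pow_pos (Fact.out (p := p.Prime)).pos e
  have key {M : Ideal R} (hM : M ≠ ⊤) : ∃ β : Fin r → ℕ, ∑ j, β j = N - m ∧
      ∏ j, h j ^ β j ∉ traceColon p e M := by
    by_contra! H
    refine hsplit.notMem_traceColon hM (SetLike.le_def.1 ?_
      (Ideal.span_range_pow_le h _ (Ideal.IsReductionOf.pow_le hred N hd)))
    rw [Ideal.span_le]
    rintro _ ⟨β, hβ, rfl⟩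
    exact H β hβ
  have hlt {M : Ideal R} (hM : Ideal.span (Set.range h) ≤ M) {β : Fin r → ℕ}
      (hβ : ∏ j, h j ^ β j ∉ traceColon p e M) (j : Fin r) : β j < p ^ e := by
    by_contra! hj
    refine hβ (Ideal.mem_of_dvd _ ((pow_dvd_pow _ hj).trans
      (Finset.dvd_prod_of_mem _ (Finset.mem_univ j))) ?_)
    exact pow_mem_traceColon (hM (Ideal.subset_span ⟨j, rfl⟩))
  -- `key` at the proper ideal I itself, which contains J, bounds N - m by r (q - 1). This puts the
  -- constant exponent q - 1 in B.
  have hbound : N' ≤ c * (p ^ e - 1) := by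
    obtain ⟨β, hβ, hβ'⟩ := key hI
    have : ∑ j, β j ≤ r * (p ^ e - 1) := by
      simpa using Finset.sum_le_card_nsmul Finset.univ β (p ^ e - 1)
        fun j _ => Nat.le_sub_one_of_lt (hlt hle hβ' j)
    refine Nat.le_of_mul_le_mul_left (hN.trans ?_) hr
    rw [← hβ, mul_left_comm]
    exact Nat.mul_le_mul_left c this
  let B : Finset (Fin c → ℕ) :=
    (Fintype.piFinset fun _ => Finset.range (p ^ e)).filter fun b => N' ≤ ∑ i, b i
  have hB (b : Fin c → ℕ) : b ∈ B ↔ (∀ i, b i < p ^ e) ∧ N' ≤ ∑ i, b i := by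
    simp [B]
  refine ⟨genericPowerSum f B, Ideal.sum_mem _ fun b hb => ?_,
    frobeniusSplitsAlong_of_coeff (fun α hα x => ?_) fun M hM => ?_⟩
  · exact Ideal.pow_le_pow_right ((hB b).1 hb).2 (Ideal.prod_pow_mem_pow _ b)
  · rw [MvPolynomial.mem_support_iff, coeff_genericPowerSum, ne_eq, ite_eq_right_iff,
      Classical.not_imp] at hα
    exact (le_weight_rowWeight α x).trans_lt (((hB _).1 hα.1).1 x.1)
  · by_contra! H
    have hmem {b : Fin c → ℕ} (hb : b ∈ B) (τ : Fin c → Fin r) :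
        ∏ i, h (τ i) ^ b i ∈ traceColon p e M :=
      prod_pow_mem_of_coeff_genericPowerSum_mem f H hb
        fun i => hf ▸ hle (Ideal.subset_span ⟨τ i, rfl⟩)
    by_cases hJM : Ideal.span (Set.range h) ≤ M
    · obtain ⟨β, hβ, hβ'⟩ := key hM.ne_top
      obtain ⟨τ, hτ, hsum⟩ := exists_injective_mul_sum_le hcr hr β
      have hb : (fun i => β (τ i)) ∈ B := (hB _).2 ⟨fun i => hlt hJM hβ' _,
        Nat.le_of_mul_le_mul_left (hN.trans (hβ ▸ hsum)) hr⟩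
      refine hβ' (Ideal.mem_of_dvd _ ?_ (hmem hb τ))
      rw [← Finset.prod_image (f := fun j => h j ^ β j) hτ.injOn]
      exact Finset.prod_dvd_prod_of_subset _ _ _ (Finset.subset_univ _)
    -- Some h_j is outside M, so exponents of a surviving monomial need not be below q. A pure power
    -- of h_j, with every b_i = q - 1, serves instead.
    · rw [Ideal.span_le, Set.range_subset_iff] at hJM
      push Not at hJM
      obtain ⟨j, hj⟩ := hJM
      have := hmem (b := fun _ => p ^ e - 1)
        ((hB _).2 ⟨fun _ => Nat.sub_one_lt_of_lt hq, by simpa using hbound⟩) fun _ => j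
      rw [Finset.prod_pow_eq_pow_sum] at this
      exact hj (hsplit.mem_of_pow_mem_traceColon (hM := hM.isPrime) this)

theorem IsFPurePair.genericCombination {c s r m : ℕ} {I : Ideal R}
    (hI : I ≠ ⊤) (f : Fin s → R) (hf : I = Ideal.span (Set.range f)) (h : Fin r → R)
    (hle : Ideal.span (Set.range h) ≤ I)
    (hred : Ideal.span (Set.range h) * I ^ m = I ^ (m + 1)) (hcr : c ≤ r) (hr : 0 < r)
    {t t' : ℝ≥0} (ht : IsFPurePair p I t) (htt' : r * t' < c * t) :
    IsFPurePair p (Ideal.span (Set.range (genericCombination c f))) t' := by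
  have hp : 1 < (p : ℝ) := by exact_mod_cast (Fact.out (p := p.Prime)).one_lt
  have hpos : (0 : ℝ) < c * t - r * t' := sub_pos.2 (by exact_mod_cast htt')
  -- In c (1 + m), the 1 pays for the floor defining N and the m for the exponent lost to the
  -- reduction.
  have hlarge : ∀ᶠ e : ℕ in Filter.atTop,
      c * (1 + m : ℝ) / (c * t - r * t') + 1 ≤ (p : ℝ) ^ e :=
    (tendsto_pow_atTop_atTop_of_one_lt hp).eventually_ge_atTop _
  filter_upwards [ht, hlarge] with e ⟨d, hd, hsplit⟩ he
  refine exists_frobeniusSplitsAlong_genericCombination hI f hf h hle hred hcr hr ?_ hd hsplit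
  have h1 : (0 : ℝ) ≤ (p : ℝ) ^ e - 1 := sub_nonneg.2 (one_le_pow₀ hp.le)
  have h2 : c * (1 + m : ℝ) ≤ ((p : ℝ) ^ e - 1) * (c * t - r * t') :=
    (div_le_iff₀ hpos).1 (by linarith)
  have h3 := Nat.floor_le (mul_nonneg t'.coe_nonneg h1)
  have h4 := (Nat.lt_floor_add_one ((t : ℝ) * ((p : ℝ) ^ e - 1))).le
  set N := ⌊(t : ℝ) * ((p : ℝ) ^ e - 1)⌋₊
  have h5 : (N : ℝ) - m ≤ ((N - m : ℕ) : ℝ) := by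
    rw [sub_le_iff_le_add]
    exact_mod_cast (le_tsub_add : N ≤ N - m + m)
  have h6 : (r : ℝ) * ⌊(t' : ℝ) * ((p : ℝ) ^ e - 1)⌋₊ ≤ c * ((N - m : ℕ) : ℝ) := by
    calc (r : ℝ) * ⌊(t' : ℝ) * ((p : ℝ) ^ e - 1)⌋₊ ≤ r * (t' * ((p : ℝ) ^ e - 1)) := by gcongr
      _ ≤ c * (t * ((p : ℝ) ^ e - 1) - 1 - m) := by linarith
      _ ≤ c * ((N - m : ℕ) : ℝ) := by gcongr; linarith
  exact_mod_cast h6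

theorem div_mul_fPureThreshold_le {c s r m : ℕ} {I : Ideal R}
    (hI : I ≠ ⊤) (f : Fin s → R) (hf : I = Ideal.span (Set.range f)) (h : Fin r → R)
    (hle : Ideal.span (Set.range h) ≤ I)
    (hred : Ideal.span (Set.range h) * I ^ m = I ^ (m + 1)) (hcr : c ≤ r) (hr : 0 < r) :
    (c : ℝ≥0∞) / (r : ℝ≥0∞) * fPureThreshold p I ≤
      fPureThreshold p (Ideal.span (Set.range (genericCombination c f))) := by
  have hr' : (r : ℝ≥0) ≠ 0 := by exact_mod_cast hr.ne'
  simp only [fPureThreshold, ENNReal.mul_iSup]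
  refine iSup₂_le fun t ht => ENNReal.le_of_forall_nnreal_lt fun t' ht' => ?_
  have hlt : (r : ℝ≥0) * t' < c * t := by
    have : (t' : ℝ≥0∞) < ((c / r * t : ℝ≥0) : ℝ≥0∞) := by
      rw [ENNReal.coe_mul, ENNReal.coe_div hr']
      simpa using ht'
    rw [ENNReal.coe_lt_coe, div_mul_eq_mul_div, lt_div_iff₀ (pos_iff_ne_zero.2 hr')] at this
    rwa [mul_comm]
  exact le_iSup₂_of_le t' (ht.genericCombination hI f hf h hle hred hcr hr hlt) le_rfl

end Threshold

theorem theorem4p3 (p : ℕ) [Fact p.Prime] (k : Type*) [Field k] [CharP k p] [PerfectField k]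
    (n c s r : ℕ) (I : Ideal (MvPolynomial (Fin n) k))
    (hunmixed : I.IsUnmixedIdeal) (hheight : I.height = c)
    (f : Fin s → MvPolynomial (Fin n) k) (hf : I = Ideal.span (Set.range f))
    (h : Fin r → MvPolynomial (Fin n) k)
    (hred : (Ideal.span (Set.range h)).IsReductionOf I) :
    (c : ℝ≥0∞) / (r : ℝ≥0∞) * fPureThreshold p I ≤
      fPureThreshold p (Ideal.span (Set.range (genericCombination c f))) := by
  obtain ⟨hle, m, hm⟩ := hred
  have hI : I ≠ ⊤ := by
    rintro rfl
    rw [Ideal.height_top] at hheight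
    exact ENat.natCast_ne_top c hheight.symm
  have hcr : c ≤ r := by
    have := Ideal.height_le_of_pow_le_span_range h hI hle (hm ▸ Ideal.mul_le_left :
      I ^ (m + 1) ≤ _)
    rw [hheight] at this
    exact_mod_cast this
  rcases Nat.eq_zero_or_pos r with rfl | hr
  -- Here c = 0, and `0 / 0 = 0` in `ℝ≥0∞`.
  · obtain rfl := Nat.le_zero.1 hcr
    simp
  · exact div_mul_fPureThreshold_le hI f hf h hle hm hcr hr
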